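/- Let $H^2(\mathbb D)$ be the Hardy space of analytic functions $f(z)=\sum_{n\ge 0}a_nz^n$ on the open unit disc $\mathbb D$ with $\|f\|^2=\sum|a_n|^2<\infty$, with reproducing kernels $K_w(z)=\frac1{1-\bar wz}$. A conjugation on a complex Hilbert space $H$ is a conjugate-linear map $C:H\to H$ with $C^2=I$ and $\langle Cx,Cy\rangle=\langle y,x\rangle$ for all $x,y$; a bounded linear operator $T$ on $H$ is called $C$-normal if $CT^*TC=TT^*$. For an analytic function $\psi$ on $\mathbb D$ and an analytic self-map $\varphi$ of $\mathbb D$ put $W_{\psi,\varphi}f=\psi\cdot(f\circ\varphi)$. Let $Jf(z)=\overline{f(\bar z)}$ and, for $|\mu|=1$, $J_\mu f(z)=\overline{f(\mu\bar z)}$. For $p\in\mathbb D\setminus\{0\}$ and $|\lambda|=1$ with $\lambda p=\bar p$ let $\xi_p(z)=\frac{\sqrt{1-|p|^2}}{1-\bar pz}$ and $\tau_p(z)=\frac{\lambda(p-z)}{1-\bar pz}$; then $J_\mu$ and $JW_{\xi_p,\tau_p}$ are conjugations on $H^2(\mathbb D)$. **Theorem.** Let $p\in\mathbb D\setminus\{0\}$,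 $|\lambda|=1$ with $\lambda p=\bar p$, and $|\mu|=1$. Let $\varphi(z)=\frac{az+b}{cz+d}$, with $a,b,c,d\in\mathbb C$ and $ad-bc\neq0$, be a linear fractional self-map of $\mathbb D$ which has a fixed point on the unit circle, and let $\psi=\beta K_{\sigma(0)}$, where $\beta\neq0$ is a constant and $\sigma(z)=\frac{\bar az-\bar c}{-\bar bz+\bar d}$. If $W_{\psi,\varphi}$ is a normal (bounded) operator on $H^2(\mathbb D)$, then: (i) $W_{\psi,\varphi}$ is $J_\mu$-normal if and only if $(\bar cd-\bar ab)\bar\mu=\bar ac-\bar bd$; (ii) $W_{\psi,\varphi}$ is $JW_{\xi_p,\tau_p}$-normal if and only if $a\bar b-c\bar d=\bar bd-\bar ac$ and $(|a|^2-|d|^2)|p|^2=2\operatorname{Re}\big((a\bar c-b\bar d)p\big)$. -/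

import Mathlib

open Complex ComplexConjugate
open scoped Complex.UnitDisc

noncomputable section

/-- The Hardy space `H²(𝔻)`: analytic functions `f(z) = ∑ aₙ zⁿ` on the unit disc with
`‖f‖² = ∑ |aₙ|² < ∞`.  An element is stored through its square-summable sequence of Taylor
coefficients and is used as a function on `𝔻` through the `RKHS` instance below. -/
def H2 : Type := lp (fun _ : ℕ => ℂ) 2

namespace H2

instance instNormedAddCommGroup : NormedAddCommGroup H2 :=
  inferInstanceAs (NormedAddCommGroup (lp (fun _ : ℕ => ℂ) 2))

instance instInnerProductSpace : InnerProductSpace ℂ H2 :=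
  inferInstanceAs (InnerProductSpace ℂ (lp (fun _ : ℕ => ℂ) 2))

instance instCompleteSpace : CompleteSpace H2 :=
  inferInstanceAs (CompleteSpace (lp (fun _ : ℕ => ℂ) 2))

/-- The `n`-th Taylor coefficient. -/
def coeff (f : H2) (n : ℕ) : ℂ := (show lp (fun _ : ℕ => ℂ) 2 from f) n

/-- The element of `H²` with a given square-summable sequence of Taylor coefficients. -/
def ofCoeff (a : ℕ → ℂ) (ha : Memℓp a 2) : H2 := (⟨a, ha⟩ : lp (fun _ : ℕ => ℂ) 2)

theorem coeff_ofCoeff (a : ℕ → ℂ) (ha : Memℓp a 2) (n : ℕ) : coeff (ofCoeff a ha) n = a n := rfl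

theorem memlp_coeff (f : H2) : Memℓp (coeff f) 2 := lp.memℓp (show lp (fun _ : ℕ => ℂ) 2 from f)

theorem coeff_ext {f g : H2} (h : ∀ n, coeff f n = coeff g n) : f = g :=
  lp.ext (funext h)

theorem coeff_add (f g : H2) (n : ℕ) : coeff (f + g) n = coeff f n + coeff g n := rfl

theorem coeff_smul (r : ℂ) (f : H2) (n : ℕ) : coeff (r • f) n = r * coeff f n := rfl

theorem inner_eq (f g : H2) : inner ℂ f g = ∑' n, conj (coeff f n) * coeff g n := by
  have h := lp.inner_eq_tsum (𝕜 := ℂ) (show lp (fun _ : ℕ => ℂ) 2 from f)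
    (show lp (fun _ : ℕ => ℂ) 2 from g)
  refine h.trans (tsum_congr fun n => ?_)
  rw [RCLike.inner_apply']
  rfl

/-- The coefficients of the reproducing kernel at `w`. -/
def kernelVec (w : 𝔻) : H2 := ofCoeff (fun n => conj (w : ℂ) ^ n) (by
  refine memℓp_gen ?_
  have h1 : ‖(w : ℂ)‖ ^ 2 < 1 := w.sq_norm_lt_one
  have h := summable_geometric_of_lt_one (sq_nonneg ‖(w : ℂ)‖) h1
  refine h.congr fun n => ?_
  simp only [ENNReal.toReal_ofNat, Real.rpow_ofNat, norm_pow, RCLike.norm_conj]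
  ring)

theorem inner_kernelVec (w : 𝔻) (f : H2) :
    inner ℂ (kernelVec w) f = ∑' n, coeff f n * (w : ℂ) ^ n := by
  rw [inner_eq]
  refine tsum_congr fun n => ?_
  simp [kernelVec, coeff_ofCoeff, mul_comm]

theorem hasSum_eval (f : H2) (z : 𝔻) :
    HasSum (fun n => coeff f n * (z : ℂ) ^ n) (∑' n, coeff f n * (z : ℂ) ^ n) := by
  have h := lp.hasSum_inner (𝕜 := ℂ) (show lp (fun _ : ℕ => ℂ) 2 from kernelVec z)
    (show lp (fun _ : ℕ => ℂ) 2 from f)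
  have h2 : Summable (fun n => coeff f n * (z : ℂ) ^ n) := by
    refine h.summable.congr fun n => ?_
    rw [RCLike.inner_apply']
    change conj (coeff (kernelVec z) n) * coeff f n = _
    simp [kernelVec, coeff_ofCoeff, mul_comm]
  exact h2.hasSum

theorem tsum_eq_inner (f : H2) (z : 𝔻) :
    ∑' n, coeff f n * (z : ℂ) ^ n = inner ℂ (kernelVec z) f := (inner_kernelVec z f).symm

theorem eq_zero_of_tsum_eq_zero (f : H2)
    (h : ∀ z : 𝔻, ∑' n, coeff f n * (z : ℂ) ^ n = 0) : f = 0 := by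
  have key : HasFPowerSeriesAt (fun _ : ℂ => (0 : ℂ))
      (FormalMultilinearSeries.ofScalars ℂ (coeff f)) 0 := by
    rw [hasFPowerSeriesAt_iff]
    filter_upwards [Metric.ball_mem_nhds (0 : ℂ) one_pos] with z hz
    have hz1 : ‖z‖ < 1 := by simpa using hz
    have hs := hasSum_eval f (UnitDisc.mk z hz1)
    rw [h] at hs
    simpa [FormalMultilinearSeries.coeff_ofScalars, mul_comm] using hs
  have h0 := key.eq_zero
  rw [FormalMultilinearSeries.ofScalars_series_eq_zero] at h0
  exact coeff_ext fun n => congrFun h0 n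

/-- An element of `H²` as a function on the disc: `f(z) = ∑ aₙ zⁿ`. -/
instance instRKHS : RKHS ℂ H2 𝔻 ℂ where
  coeCLM :=
    { toFun := fun f z => ∑' n, coeff f n * (z : ℂ) ^ n
      map_add' := fun f g => by
        funext z
        simp only [tsum_eq_inner, inner_add_right, Pi.add_apply]
      map_smul' := fun r f => by
        funext z
        simp only [tsum_eq_inner, inner_smul_right, Pi.smul_apply, RingHom.id_apply, smul_eq_mul]
      cont := by
        refine continuous_pi fun z => ?_
        simp only [tsum_eq_inner]
        fun_prop }
  coeCLM_injective := by
    intro f g hfg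
    have h0 : f - g = 0 := by
      apply eq_zero_of_tsum_eq_zero
      intro z
      have h1 : (∑' n, coeff f n * (z : ℂ) ^ n) = ∑' n, coeff g n * (z : ℂ) ^ n :=
        congrFun hfg z
      rw [tsum_eq_inner, tsum_eq_inner] at h1
      rw [tsum_eq_inner, inner_sub_right, h1, sub_self]
    exact sub_eq_zero.mp h0

theorem apply_eq (f : H2) (z : 𝔻) : f z = ∑' n, coeff f n * (z : ℂ) ^ n := rfl

theorem inner_kernelVec_left (w : 𝔻) (f : H2) : inner ℂ (kernelVec w) f = f w :=
  inner_kernelVec w f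

theorem kerFun_eq (w : 𝔻) (v : ℂ) : RKHS.kerFun H2 w v = v • kernelVec w := by
  refine ext_inner_right ℂ fun f => ?_
  rw [RKHS.kerFun_inner, inner_smul_left, inner_kernelVec_left, RCLike.inner_apply']

end H2

/-- The kernel `K_w(z) = 1 / (1 - w̄ z)`. -/
def szegoKernel (w z : ℂ) : ℂ := 1 / (1 - conj w * z)

theorem H2.kernelVec_apply (w z : 𝔻) : H2.kernelVec w z = szegoKernel w z := by
  rw [H2.apply_eq]
  have h1 : ‖conj (w : ℂ) * z‖ < 1 := by
    rw [norm_mul, RCLike.norm_conj]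
    exact mul_lt_one_of_nonneg_of_lt_one_left (norm_nonneg _) w.norm_lt_one z.norm_lt_one.le
  simp only [H2.kernelVec, H2.coeff_ofCoeff, ← mul_pow]
  rw [tsum_geometric_of_norm_lt_one h1, szegoKernel, one_div]

/-- The bounded operator `W` on `H²` is the weighted composition operator `W_{ψ,φ}`,
`(W f)(z) = ψ(z) f(φ(z))`. -/
def IsWeightedComposition (ψ : 𝔻 → ℂ) (φ : 𝔻 → 𝔻) (W : H2 →L[ℂ] H2) : Prop :=
  ∀ (f : H2) (z : 𝔻), W f z = ψ z * f (φ z)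

/-- A conjugation: a conjugate-linear map `C` with `⟪Cx, Cy⟫ = ⟪y, x⟫` and `C² = I`. -/
structure Conjugation (H : Type*) [NormedAddCommGroup H] [InnerProductSpace ℂ H] where
  toMap : H →ₛₗ[starRingEnd ℂ] H
  inner_map : ∀ x y : H, inner ℂ (toMap x) (toMap y) = inner ℂ y x
  map_map : ∀ x : H, toMap (toMap x) = x

/-- `T` is `C`-normal: `C T* T C = T T*`. -/
def IsCNormal {H : Type*} [NormedAddCommGroup H] [InnerProductSpace ℂ H] [CompleteSpace H]
    (C : Conjugation H) (T : H →L[ℂ] H) : Prop :=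
  ∀ x : H, C.toMap (ContinuousLinearMap.adjoint T (T (C.toMap x))) =
    T (ContinuousLinearMap.adjoint T x)

/-- The conjugation `(J_μ f)(z) = conj (f (μ z̄))`, which maps `∑ aₙ zⁿ` to `∑ conj (aₙ μⁿ) zⁿ`;
see `conjJ_apply`. -/
def conjJ (μ : Circle) : Conjugation H2 where
  toMap :=
    { toFun := fun f => H2.ofCoeff (fun n => conj (H2.coeff f n * (μ : ℂ) ^ n)) (by
        refine (H2.memlp_coeff f).mono' fun n => ?_
        simp [Circle.norm_coe])
      map_add' := fun f g => H2.coeff_ext fun n => by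
        simp only [H2.coeff_ofCoeff, H2.coeff_add, add_mul, map_add]
      map_smul' := fun r f => H2.coeff_ext fun n => by
        simp only [H2.coeff_ofCoeff, H2.coeff_smul, map_mul, mul_assoc] }
  inner_map := fun f g => by
    rw [H2.inner_eq, H2.inner_eq]
    refine tsum_congr fun n => ?_
    have hμ : (μ : ℂ) ^ n * conj (μ : ℂ) ^ n = 1 := by
      rw [← mul_pow, Complex.mul_conj]
      simp
    simp only [LinearMap.coe_mk, AddHom.coe_mk, H2.coeff_ofCoeff, map_mul, map_pow, conj_conj]
    linear_combination H2.coeff f n * conj (H2.coeff g n) * hμ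
  map_map := fun f => H2.coeff_ext fun n => by
    have hμ : (μ : ℂ) ^ n * conj (μ : ℂ) ^ n = 1 := by
      rw [← mul_pow, Complex.mul_conj]
      simp
    simp only [LinearMap.coe_mk, AddHom.coe_mk, H2.coeff_ofCoeff, map_mul, map_pow, conj_conj]
    linear_combination H2.coeff f n * hμ

theorem conjJ_apply (μ : Circle) (f : H2) (z : 𝔻) :
    (conjJ μ).toMap f z = conj (f (μ • star z)) := by
  rw [H2.apply_eq, H2.apply_eq, Complex.conj_tsum]
  refine tsum_congr fun n => ?_
  simp only [conjJ, LinearMap.coe_mk, AddHom.coe_mk, H2.coeff_ofCoeff, map_mul, map_pow,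
    UnitDisc.coe_circle_smul, UnitDisc.coe_star, conj_conj, mul_pow]
  ring

/-- `ξ_p(z) = √(1 - |p|²) / (1 - p̄ z)`. -/
def xi (p : 𝔻) (z : 𝔻) : ℂ := (Real.sqrt (1 - ‖(p : ℂ)‖ ^ 2) : ℂ) / (1 - conj (p : ℂ) * z)

theorem one_sub_conj_mul_ne_zero (p z : 𝔻) : (1 - conj (p : ℂ) * z) ≠ 0 := by
  intro h
  have h1 : ‖conj (p : ℂ) * z‖ < 1 := by
    rw [norm_mul, RCLike.norm_conj]
    exact mul_lt_one_of_nonneg_of_lt_one_left (norm_nonneg _) p.norm_lt_one z.norm_lt_one.le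
  rw [← sub_eq_zero.mp h] at h1
  simp at h1

theorem norm_tau_lt_one (lam : Circle) (p z : 𝔻) :
    ‖(lam : ℂ) * ((p : ℂ) - z) / (1 - conj (p : ℂ) * z)‖ < 1 := by
  have hp := p.normSq_lt_one
  have hz := z.normSq_lt_one
  have h0 : 0 < ‖1 - conj (p : ℂ) * z‖ := norm_pos_iff.mpr (one_sub_conj_mul_ne_zero p z)
  rw [norm_div, norm_mul, Circle.norm_coe, one_mul, div_lt_one h0]
  refine lt_of_pow_lt_pow_left₀ 2 h0.le ?_
  rw [Complex.sq_norm, Complex.sq_norm]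
  simp only [Complex.normSq_apply, Complex.sub_re, Complex.sub_im, Complex.mul_re, Complex.mul_im,
    Complex.conj_re, Complex.conj_im, Complex.one_re, Complex.one_im] at *
  nlinarith [mul_pos (sub_pos.mpr hp) (sub_pos.mpr hz)]

/-- The disc automorphism `τ_p(z) = λ (p - z) / (1 - p̄ z)`, with `|λ| = 1`. -/
def tau (lam : Circle) (p : 𝔻) (z : 𝔻) : 𝔻 :=
  UnitDisc.mk ((lam : ℂ) * ((p : ℂ) - z) / (1 - conj (p : ℂ) * z)) (norm_tau_lt_one lam p z)

theorem coe_tau (lam : Circle) (p z : 𝔻) :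
    (tau lam p z : ℂ) = (lam : ℂ) * ((p : ℂ) - z) / (1 - conj (p : ℂ) * z) := rfl

theorem sqrt_mul_self_xi (p : 𝔻) : (Real.sqrt (1 - ‖(p : ℂ)‖ ^ 2) : ℂ) *
    (Real.sqrt (1 - ‖(p : ℂ)‖ ^ 2) : ℂ) = 1 - (p : ℂ) * conj (p : ℂ) := by
  have h : 0 ≤ 1 - ‖(p : ℂ)‖ ^ 2 := (sub_pos.mpr p.sq_norm_lt_one).le
  rw [← Complex.ofReal_mul, Real.mul_self_sqrt h, Complex.mul_conj, Complex.normSq_eq_norm_sq]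
  push_cast
  ring

theorem circle_mul_conj (lam : Circle) : (lam : ℂ) * conj (lam : ℂ) = 1 := by
  rw [Complex.mul_conj]
  simp

theorem xi_kernel (lam : Circle) (p z w : 𝔻) :
    xi p z * conj (xi p w) * szegoKernel (tau lam p w) (tau lam p z) = szegoKernel w z := by
  have h1 := one_sub_conj_mul_ne_zero p z
  have h2 := one_sub_conj_mul_ne_zero p w
  have h2' : (1 - (p : ℂ) * conj (w : ℂ)) ≠ 0 := by
    have := (map_ne_zero (starRingEnd ℂ)).mpr h2
    simpa using this
  have h2'' : (1 - conj (w : ℂ) * (p : ℂ)) ≠ 0 := by rwa [mul_comm] at h2'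
  have h3 := one_sub_conj_mul_ne_zero w z
  have h4 := one_sub_conj_mul_ne_zero (tau lam p w) (tau lam p z)
  have hs := sqrt_mul_self_xi p
  have hl := circle_mul_conj lam
  simp only [szegoKernel, xi]
  have h5 : (1 - conj (tau lam p w : ℂ) * (tau lam p z : ℂ)) =
      (1 - (p : ℂ) * conj (p : ℂ)) * (1 - conj (w : ℂ) * z) /
        ((1 - conj (p : ℂ) * z) * (1 - (p : ℂ) * conj (w : ℂ))) := by
    simp only [coe_tau, map_div₀, map_mul, map_sub, map_one, conj_conj]
    field_simp
    linear_combination (-((p : ℂ) - z) * (conj (p : ℂ) - conj (w : ℂ))) * hl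
  have h6 : (1 - (p : ℂ) * conj (p : ℂ)) ≠ 0 := by
    intro h
    rw [h5, h] at h4
    simp at h4
  have h6' : (1 - conj (p : ℂ) * (p : ℂ)) ≠ 0 := by rwa [mul_comm] at h6
  rw [h5]
  simp only [map_div₀, map_mul, map_sub, map_one, conj_conj, Complex.conj_ofReal]
  field_simp
  rw [pow_two, hs, mul_comm (p : ℂ)]

/-- A weighted composition whose symbols preserve the kernel acts as a contraction on `H²`. -/
theorem exists_isWeightedComposition (ψ : 𝔻 → ℂ) (φ : 𝔻 → 𝔻)
    (h : ∀ z w : 𝔻, ψ z * conj (ψ w) * szegoKernel (φ w) (φ z) = szegoKernel w z) :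
    ∃ W : H2 →L[ℂ] H2, IsWeightedComposition ψ φ W ∧ ∀ f, ‖W f‖ ≤ ‖f‖ := by
  let e : (𝔻 →₀ ℂ) →ₗ[ℂ] H2 := Finsupp.linearCombination ℂ H2.kernelVec
  let v : (𝔻 →₀ ℂ) →ₗ[ℂ] H2 :=
    Finsupp.linearCombination ℂ (fun w => conj (ψ w) • H2.kernelVec (φ w))
  have hin : ∀ z w : 𝔻, inner ℂ (conj (ψ z) • H2.kernelVec (φ z))
      (conj (ψ w) • H2.kernelVec (φ w)) = inner ℂ (H2.kernelVec z) (H2.kernelVec w) := by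
    intro z w
    rw [inner_smul_left, inner_smul_right, H2.inner_kernelVec_left, H2.inner_kernelVec_left,
      H2.kernelVec_apply, H2.kernelVec_apply, ← h z w, conj_conj, mul_assoc]
  have hnorm : ∀ x, ‖v x‖ ≤ 1 * ‖e x‖ := by
    intro x
    have hxx : inner ℂ (v x) (v x) = inner ℂ (e x) (e x) := by
      simp only [v, e, Finsupp.linearCombination_apply, Finsupp.sum, sum_inner, inner_sum]
      refine Finset.sum_congr rfl fun i _ => Finset.sum_congr rfl fun j _ => ?_
      rw [inner_smul_left, inner_smul_right, hin, inner_smul_left, inner_smul_right]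
    rw [one_mul, @norm_eq_sqrt_re_inner ℂ, @norm_eq_sqrt_re_inner ℂ _ _ _ _ (e x), hxx]
  have hd : DenseRange e := by
    have h1 := RKHS.kerFun_dense (𝕜 := ℂ) (H := H2) (X := 𝔻) (V := ℂ)
    have h2 : Submodule.span ℂ {RKHS.kerFun H2 x v | (x : 𝔻) (v : ℂ)} ≤ LinearMap.range e := by
      rw [Submodule.span_le]
      rintro _ ⟨x, c, rfl⟩
      exact ⟨Finsupp.single x c, by simp [e, H2.kerFun_eq]⟩
    have h3 : (LinearMap.range e).topologicalClosure = ⊤ :=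
      top_le_iff.mp (h1 ▸ Submodule.topologicalClosure_mono h2)
    have h4 := Submodule.dense_iff_topologicalClosure_eq_top.mpr h3
    rwa [LinearMap.coe_range] at h4
  let V : H2 →L[ℂ] H2 := v.extendOfNorm e
  have hV : ∀ w, V (H2.kernelVec w) = conj (ψ w) • H2.kernelVec (φ w) := by
    intro w
    have h1 := LinearMap.extendOfNorm_eq hd ⟨1, hnorm⟩ (Finsupp.single w 1)
    simpa [e, v] using h1
  have hVn : ‖V‖ ≤ 1 := ContinuousLinearMap.opNorm_le_bound _ zero_le_one
    (LinearMap.norm_extendOfNorm_apply_le hd 1 hnorm)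
  refine ⟨ContinuousLinearMap.adjoint V, fun f z => ?_, fun f => ?_⟩
  · rw [← H2.inner_kernelVec_left, ContinuousLinearMap.adjoint_inner_right, hV, inner_smul_left,
      conj_conj, H2.inner_kernelVec_left]
  · refine (ContinuousLinearMap.le_opNorm _ f).trans ?_
    rw [LinearIsometryEquiv.norm_map]
    exact mul_le_of_le_one_left (norm_nonneg _) hVn

/-- The weighted composition operator `W_{ξ_p,τ_p}` on `H²`. -/
def opXiTau (lam : Circle) (p : 𝔻) : H2 →L[ℂ] H2 :=
  Classical.choose (exists_isWeightedComposition (xi p) (tau lam p) (xi_kernel lam p))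

theorem opXiTau_apply (lam : Circle) (p : 𝔻) (f : H2) (z : 𝔻) :
    opXiTau lam p f z = xi p z * f (tau lam p z) :=
  (Classical.choose_spec
    (exists_isWeightedComposition (xi p) (tau lam p) (xi_kernel lam p))).1 f z

theorem norm_opXiTau_le (lam : Circle) (p : 𝔻) (f : H2) : ‖opXiTau lam p f‖ ≤ ‖f‖ :=
  (Classical.choose_spec
    (exists_isWeightedComposition (xi p) (tau lam p) (xi_kernel lam p))).2 f

theorem Conjugation.norm_map {H : Type*} [NormedAddCommGroup H] [InnerProductSpace ℂ H]
    (C : Conjugation H) (x : H) : ‖C.toMap x‖ = ‖x‖ := by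
  rw [@norm_eq_sqrt_re_inner ℂ, @norm_eq_sqrt_re_inner ℂ _ _ _ _ x, C.inner_map]

theorem conjJ_one_opXiTau_apply (lam : Circle) (p : 𝔻) (f : H2) (z : 𝔻) :
    (conjJ 1).toMap (opXiTau lam p f) z = conj (xi p (star z) * f (tau lam p (star z))) := by
  rw [conjJ_apply, one_smul, opXiTau_apply]

theorem conjJ_one_opXiTau_involutive (lam : Circle) (p : 𝔻)
    (h : (lam : ℂ) * p = conj (p : ℂ)) (f : H2) :
    (conjJ 1).toMap (opXiTau lam p ((conjJ 1).toMap (opXiTau lam p f))) = f := by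
  refine RKHS.ext fun z => ?_
  rw [conjJ_one_opXiTau_apply, conjJ_one_opXiTau_apply]
  have h' : conj (lam : ℂ) * conj (p : ℂ) = p := by
    have := congrArg conj h
    simpa using this
  have hl := circle_mul_conj lam
  have hs := sqrt_mul_self_xi p
  have h1 : (1 - (p : ℂ) * z) ≠ 0 := by
    have := one_sub_conj_mul_ne_zero (star p) z
    simpa using this
  have h6 : (1 - (p : ℂ) * conj (p : ℂ)) ≠ 0 := by
    have := one_sub_conj_mul_ne_zero p p
    rwa [mul_comm] at this
  have hu : ((star (tau lam p (star z)) : 𝔻) : ℂ) =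
      ((p : ℂ) - conj (lam : ℂ) * z) / (1 - (p : ℂ) * z) := by
    simp only [UnitDisc.coe_star, coe_tau, map_div₀, map_mul, map_sub, map_one, conj_conj]
    rw [mul_sub, h']
  have hden : 1 - conj (p : ℂ) * ((star (tau lam p (star z)) : 𝔻) : ℂ) =
      (1 - (p : ℂ) * conj (p : ℂ)) / (1 - (p : ℂ) * z) := by
    rw [hu]
    field_simp
    linear_combination (z : ℂ) * h'
  have ht : tau lam p (star (tau lam p (star z))) = z := by
    apply UnitDisc.coe_injective
    rw [coe_tau, hden, hu]
    field_simp
    linear_combination (z : ℂ) * hl - (z : ℂ) * (p : ℂ) * h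
  have hx : conj (xi p (star z)) * xi p (star (tau lam p (star z))) = 1 := by
    rw [xi, xi, hden]
    simp only [UnitDisc.coe_star, map_div₀, map_mul, map_sub, map_one, conj_conj,
      Complex.conj_ofReal]
    field_simp
    rw [pow_two, hs]
  rw [ht, map_mul, conj_conj, ← mul_assoc, hx, one_mul]

/-- The conjugation `J W_{ξ_p,τ_p}` on `H²`, where `|λ| = 1` and `λ p = p̄`. -/
def conjJW (lam : Circle) (p : 𝔻) (h : (lam : ℂ) * p = conj (p : ℂ)) : Conjugation H2 where
  toMap := (conjJ 1).toMap.comp (opXiTau lam p).toLinearMap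
  inner_map := by
    have hn : ∀ f, ‖opXiTau lam p f‖ = ‖f‖ := by
      intro f
      refine le_antisymm (norm_opXiTau_le lam p f) ?_
      have h1 := conjJ_one_opXiTau_involutive lam p h f
      have h2 := norm_opXiTau_le lam p ((conjJ 1).toMap (opXiTau lam p f))
      rw [← (conjJ 1).norm_map (opXiTau lam p ((conjJ 1).toMap (opXiTau lam p f))), h1,
        (conjJ 1).norm_map] at h2
      exact h2
    let L : H2 →ₗᵢ[ℂ] H2 := ⟨(opXiTau lam p).toLinearMap, hn⟩
    intro f g
    exact ((conjJ 1).inner_map _ _).trans (L.inner_map_map g f)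
  map_map := fun f => conjJ_one_opXiTau_involutive lam p h f

/-- The self-map `φ` of the disc is the (nonconstant) linear fractional map
`z ↦ (a z + b) / (c z + d)`. -/
def IsLinearFractional (a b c d : ℂ) (φ : 𝔻 → 𝔻) : Prop :=
  a * d - b * c ≠ 0 ∧ ∀ z : 𝔻, c * z + d ≠ 0 ∧ (φ z : ℂ) = (a * z + b) / (c * z + d)

/-- The map `z ↦ (a z + b) / (c z + d)` has a fixed point on the unit circle. -/
def HasBoundaryFixedPoint (a b c d : ℂ) : Prop :=
  ∃ ζ : ℂ, ‖ζ‖ = 1 ∧ c * ζ + d ≠ 0 ∧ (a * ζ + b) / (c * ζ + d) = ζ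

/-- `σ(z) = (ā z - c̄) / (-b̄ z + d̄)`. -/
def sigma (a b c d z : ℂ) : ℂ := (conj a * z - conj c) / (-conj b * z + conj d)

end

/-! The operator, its adjoint and both conjugations all send a reproducing kernel to a multiple of a
reproducing kernel. `C`-normality can be tested on kernels (`isCNormal_iff_kernelVec`), so every
condition becomes an identity between explicit functions of `z` and `conj w`.

The weight `ψ(z) = βd/(cz + d)` cancels the denominator of `φ`, hence `W K_w` is a multiple of
`K_{σ(w)}` (`apply_kernelVec`), while `W* K_w` is a multiple of `K_{φ(w)}`. The inner products of
such vectors are `|βd|²` divided by a polynomial affine in `z` and in `conj w`. Put `E = a c̄ - b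
d̄`; for `W* W` the polynomial is `(|d|² - |c|²) + E w̄ + Ē z + (|b|² - |a|²) z w̄`. Comparing it
with the one for `W W*`, normality gives `|b| = |c|` and `E = c̄ d - ā b`.

By normality `W W*` may be replaced by `W* W`, so `C`-normality says that this polynomial is
invariant under the substitution induced by `C`. For `J_μ` this means `E μ̄ = Ē`. For `J
W_{ξ_p,τ_p}` the defect is a fixed nonzero polynomial times one real scalar, whose vanishing is the
second equation of (ii); the first equation of (ii) is the conjugate of the normality relation. -/

/-- A function affine in `z` and in `conj w` that vanishes for all `z` and `w` in the disc has
vanishing coefficients. -/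
theorem coeffs_eq_zero_of_forall_unitDisc {A B C D : ℂ}
    (h : ∀ z w : 𝔻, A + B * conj (w : ℂ) + C * z + D * (conj (w : ℂ) * z) = 0) :
    A = 0 ∧ B = 0 ∧ C = 0 ∧ D = 0 := by
  have hn : ‖(1 / 2 : ℂ)‖ < 1 := by norm_num
  -- The values at `0` and `1/2` in each variable determine the four coefficients; the last one is a
  -- mixed second difference.
  have h00 := h 0 0
  have h10 := h (UnitDisc.mk _ hn) 0
  have h01 := h 0 (UnitDisc.mk _ hn)
  have h11 := h (UnitDisc.mk _ hn) (UnitDisc.mk _ hn)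
  have hc : conj (1 / 2 : ℂ) = 1 / 2 := by
    rw [map_div₀, map_one, map_ofNat]
  simp only [UnitDisc.coe_zero, UnitDisc.coe_mk, map_zero, hc, mul_zero, zero_mul, add_zero]
    at h00 h10 h01 h11
  refine ⟨h00, ?_, ?_, ?_⟩
  · linear_combination 2 * h01 - 2 * h00
  · linear_combination 2 * h10 - 2 * h00
  · linear_combination 4 * h11 - 4 * h01 - 4 * h10 + 4 * h00

/-! ### Kernels under adjoints and conjugations -/

/-- The adjoint of a weighted composition operator maps kernels to multiples of kernels. -/
theorem IsWeightedComposition.adjoint_kernelVec {ψ : 𝔻 → ℂ} {φ : 𝔻 → 𝔻} {W : H2 →L[ℂ] H2}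
    (hW : IsWeightedComposition ψ φ W) (w : 𝔻) :
    ContinuousLinearMap.adjoint W (H2.kernelVec w) = conj (ψ w) • H2.kernelVec (φ w) := by
  refine ext_inner_right ℂ fun f => ?_
  rw [ContinuousLinearMap.adjoint_inner_left, H2.inner_kernelVec_left, hW, inner_smul_left,
    H2.inner_kernelVec_left, conj_conj]

theorem Conjugation.inner_map_left {H : Type*} [NormedAddCommGroup H] [InnerProductSpace ℂ H]
    (C : Conjugation H) (x y : H) : inner ℂ (C.toMap x) y = inner ℂ (C.toMap y) x := by
  conv_lhs => rw [← C.map_map y]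
  exact C.inner_map _ _

theorem Conjugation.inner_map_right {H : Type*} [NormedAddCommGroup H] [InnerProductSpace ℂ H]
    (C : Conjugation H) (x y : H) : inner ℂ x (C.toMap y) = inner ℂ y (C.toMap x) := by
  conv_lhs => rw [← C.map_map x]
  exact C.inner_map _ _

/-- `C`-normality on the Hardy space may be tested on kernels. -/
theorem isCNormal_iff_kernelVec (C : Conjugation H2) (T : H2 →L[ℂ] H2) :
    IsCNormal C T ↔ ∀ z w : 𝔻,
      inner ℂ (T (C.toMap (H2.kernelVec w))) (T (C.toMap (H2.kernelVec z))) =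
      inner ℂ (ContinuousLinearMap.adjoint T (H2.kernelVec z))
        (ContinuousLinearMap.adjoint T (H2.kernelVec w)) := by
  have hl : ∀ x z, C.toMap (ContinuousLinearMap.adjoint T (T (C.toMap x))) z =
      inner ℂ (T (C.toMap x)) (T (C.toMap (H2.kernelVec z))) := by
    intro x z
    rw [← H2.inner_kernelVec_left, C.inner_map_right, ContinuousLinearMap.adjoint_inner_left]
  have hr : ∀ x z, T (ContinuousLinearMap.adjoint T x) z =
      inner ℂ (ContinuousLinearMap.adjoint T (H2.kernelVec z))
        (ContinuousLinearMap.adjoint T x) := by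
    intro x z
    rw [← H2.inner_kernelVec_left, ContinuousLinearMap.adjoint_inner_left]
  constructor
  · intro h z w
    rw [← hl, ← hr, h]
  · intro h x
    have hk : ∀ z : 𝔻, C.toMap (ContinuousLinearMap.adjoint T (T (C.toMap (H2.kernelVec z)))) =
        T (ContinuousLinearMap.adjoint T (H2.kernelVec z)) := by
      intro z
      refine RKHS.ext fun w => ?_
      rw [hl, hr, h]
    -- Both `C T* T C` and `T T*` are symmetric, so the value at `z` for a general `x` is an inner
    -- product of `x` with the image of `K_z`. Agreement on kernels therefore suffices, without a
    -- density argument.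
    refine RKHS.ext fun z => ?_
    rw [← H2.inner_kernelVec_left, C.inner_map_right, ContinuousLinearMap.adjoint_inner_left,
      ← ContinuousLinearMap.adjoint_inner_right, C.inner_map_left, hk,
      ← ContinuousLinearMap.adjoint_inner_right, hr]

theorem conjJ_kernelVec (μ : Circle) (w : 𝔻) :
    (conjJ μ).toMap (H2.kernelVec w) = H2.kernelVec (μ • star w) := by
  refine RKHS.ext fun z => ?_
  rw [conjJ_apply, H2.kernelVec_apply, H2.kernelVec_apply]
  simp only [szegoKernel, UnitDisc.coe_circle_smul, UnitDisc.coe_star, map_div₀, map_sub, map_mul,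
    map_one, conj_conj]
  congr 2
  ring

theorem conjJW_kernelVec (lam : Circle) (p : 𝔻) (h : (lam : ℂ) * p = conj (p : ℂ)) (w : 𝔻) :
    (conjJW lam p h).toMap (H2.kernelVec w) =
      conj (xi p (star w)) • H2.kernelVec (tau lam p (star w)) := by
  refine ext_inner_right ℂ fun f => ?_
  have h1 : inner ℂ ((conjJW lam p h).toMap (H2.kernelVec w)) f =
      inner ℂ ((conjJW lam p h).toMap f) (H2.kernelVec w) := Conjugation.inner_map_left _ _ _
  have h2 : (conjJW lam p h).toMap f w = conj (xi p (star w) * f (tau lam p (star w))) :=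
    conjJ_one_opXiTau_apply lam p f w
  rw [h1, ← inner_conj_symm, H2.inner_kernelVec_left, h2, conj_conj, inner_smul_left, conj_conj,
    H2.inner_kernelVec_left]

/-- The denominator of the kernel of `W* W`. -/
noncomputable def gramDenom (a b c d : ℂ) (z w : ℂ) : ℂ :=
  (conj d - z * conj b) * (d - conj w * b) - (z * conj a - conj c) * (conj w * a - c)

/-! ### The adjoint symbol of a linear fractional self-map -/

namespace IsLinearFractional

variable {a b c d β : ℂ} {φ : 𝔻 → 𝔻}

/-- The bound `|φ| < 1` on the open disc passes to the closed disc by continuity, in a form free of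
division since `cz + d` is not known to be nonzero on the circle. -/
theorem norm_numerator_le (hφ : IsLinearFractional a b c d φ) {z : ℂ} (hz : ‖z‖ ≤ 1) :
    ‖a * z + b‖ ≤ ‖c * z + d‖ := by
  have hz' : z ∈ closure (Metric.ball (0 : ℂ) 1) := by
    rw [closure_ball _ one_ne_zero]
    simpa using hz
  refine le_on_closure (f := fun z : ℂ => ‖a * z + b‖) (g := fun z : ℂ => ‖c * z + d‖) ?_
    (by fun_prop) (by fun_prop) hz'
  intro x hx
  obtain ⟨h1, h2⟩ := hφ.2 (UnitDisc.mk x (by simpa using hx))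
  have h3 := (φ (UnitDisc.mk x (by simpa using hx))).norm_lt_one
  rw [h2, norm_div, div_lt_one (norm_pos_iff.mpr h1)] at h3
  exact h3.le

/-- Since `|w| < 1`, a zero would force `az + b = 0` and then `cz + d = 0`, against `ad - bc ≠ 0`.
-/
theorem adjoint_denom_ne_zero (hφ : IsLinearFractional a b c d φ) (w : 𝔻) {z : ℂ} (hz : ‖z‖ ≤ 1) :
    c * z + d - conj (w : ℂ) * (a * z + b) ≠ 0 := by
  intro h
  have h1 : c * z + d = conj (w : ℂ) * (a * z + b) := sub_eq_zero.mp h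
  have h2 := hφ.norm_numerator_le hz
  have hw := w.norm_lt_one
  have h3 : a * z + b = 0 := by
    by_contra h0
    have h0' := norm_pos_iff.mpr h0
    rw [h1, norm_mul, RCLike.norm_conj] at h2
    nlinarith
  rw [h3, mul_zero] at h1
  have h4 := hφ.1
  by_cases hz0 : z = 0
  · subst hz0
    simp only [mul_zero, zero_add] at h1 h3
    simp [h1, h3] at h4
  · refine h4 (mul_right_cancel₀ hz0 ?_)
    linear_combination d * h3 - b * h1

theorem adjoint_denom_zero_ne_zero (hφ : IsLinearFractional a b c d φ) (w : 𝔻) :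
    d - conj (w : ℂ) * b ≠ 0 := by
  simpa using hφ.adjoint_denom_ne_zero w (z := 0) (by simp)

/-- If `|σ(w)| ≥ 1`, the reciprocal of `conj σ(w)` lies in the closed disc and is a zero of `cz + d
- w̄(az + b)`, which has none there. The reciprocal is written as a quotient to allow a value `0`.
-/
theorem norm_sigma_lt_one (hφ : IsLinearFractional a b c d φ) (w : 𝔻) :
    ‖sigma a b c d w‖ < 1 := by
  have hd := hφ.adjoint_denom_zero_ne_zero w
  have hs : sigma a b c d w = conj ((conj (w : ℂ) * a - c) / (d - conj (w : ℂ) * b)) := by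
    simp only [sigma, map_div₀, map_sub, map_mul, conj_conj]
    congr 1 <;> ring
  rw [hs, RCLike.norm_conj, norm_div, div_lt_one (norm_pos_iff.mpr hd)]
  by_contra! hle
  have hne : conj (w : ℂ) * a - c ≠ 0 := by
    intro h0
    rw [h0, norm_zero] at hle
    exact hd (norm_le_zero_iff.mp hle)
  refine hφ.adjoint_denom_ne_zero w
    (z := (d - conj (w : ℂ) * b) / (conj (w : ℂ) * a - c)) ?_ ?_
  · rw [norm_div]
    exact (div_le_one (norm_pos_iff.mpr hne)).mpr hle
  · field_simp
    ring

/-- The adjoint symbol `σ` as a self-map of the disc. -/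
noncomputable def adjointMap (hφ : IsLinearFractional a b c d φ) (w : 𝔻) : 𝔻 :=
  UnitDisc.mk (sigma a b c d w) (hφ.norm_sigma_lt_one w)

theorem conj_adjointMap (hφ : IsLinearFractional a b c d φ) (w : 𝔻) :
    conj (hφ.adjointMap w : ℂ) = (conj (w : ℂ) * a - c) / (d - conj (w : ℂ) * b) := by
  simp only [adjointMap, UnitDisc.coe_mk, sigma, map_div₀, map_add, map_sub, map_mul, map_neg,
    conj_conj]
  congr 1 <;> ring

theorem coe_adjointMap (hφ : IsLinearFractional a b c d φ) (w : 𝔻) :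
    (hφ.adjointMap w : ℂ) = (w * conj a - conj c) / (conj d - w * conj b) := by
  simp only [adjointMap, UnitDisc.coe_mk, sigma]
  congr 1 <;> ring

theorem weight_eq (hφ : IsLinearFractional a b c d φ) (z : 𝔻) :
    β * szegoKernel (sigma a b c d 0) z = β * d / (c * z + d) := by
  have hd : d ≠ 0 := by simpa using (hφ.2 0).1
  have hz := (hφ.2 z).1
  have h : 1 - conj (sigma a b c d 0) * z = (c * z + d) / d := by
    simp only [sigma, map_div₀, map_add, map_sub, map_mul, map_neg, conj_conj, map_zero]
    rw [add_div, div_self hd, mul_zero, mul_zero, zero_add, zero_sub]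
    ring
  rw [szegoKernel, h]
  field_simp

/-! ### Gram functions of `W* W` and `W W*` on kernels -/

variable {W : H2 →L[ℂ] H2}

/-- Both sides equal `βd / (cz + d - w̄(az + b))` at `z`: the weight cancels the denominator of `φ`,
and what remains is again a kernel, now based at `σ(w)`. -/
theorem apply_kernelVec (hφ : IsLinearFractional a b c d φ)
    (hW : IsWeightedComposition (fun z => β * szegoKernel (sigma a b c d 0) z) φ W) (w : 𝔻) :
    W (H2.kernelVec w) =
      (β * d / (d - conj (w : ℂ) * b)) • H2.kernelVec (hφ.adjointMap w) := by
  refine RKHS.ext fun z => ?_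
  have hr : ((β * d / (d - conj (w : ℂ) * b)) • H2.kernelVec (hφ.adjointMap w)) z =
      (β * d / (d - conj (w : ℂ) * b)) * H2.kernelVec (hφ.adjointMap w) z := by
    rw [← H2.inner_kernelVec_left, inner_smul_right, H2.inner_kernelVec_left]
  have h1 := hφ.adjoint_denom_zero_ne_zero w
  have h2 := hφ.adjoint_denom_ne_zero w z.norm_lt_one.le
  obtain ⟨h3, h4⟩ := hφ.2 z
  have h5 : 1 - conj (w : ℂ) * φ z =
      (c * z + d - conj (w : ℂ) * (a * z + b)) / (c * z + d) := by
    rw [h4, mul_div_assoc', one_sub_div h3]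
  have h6 : 1 - conj (hφ.adjointMap w : ℂ) * z =
      (c * z + d - conj (w : ℂ) * (a * z + b)) / (d - conj (w : ℂ) * b) := by
    rw [conj_adjointMap]
    field_simp
    ring
  rw [hW, hr]
  beta_reduce
  rw [hφ.weight_eq, H2.kernelVec_apply, H2.kernelVec_apply, szegoKernel, szegoKernel, h5, h6]
  generalize c * (z : ℂ) + d - conj (w : ℂ) * (a * z + b) = u at h2
  generalize d - conj (w : ℂ) * b = v at h1
  generalize c * (z : ℂ) + d = t at h3
  field_simp

theorem gramDenom_ne_zero (hφ : IsLinearFractional a b c d φ) (z w : 𝔻) :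
    gramDenom a b c d z w ≠ 0 := by
  have h1 := hφ.adjoint_denom_zero_ne_zero w
  have h2 := (map_ne_zero (starRingEnd ℂ)).mpr (hφ.adjoint_denom_zero_ne_zero z)
  simp only [map_sub, map_mul, conj_conj] at h2
  have h3 := one_sub_conj_mul_ne_zero (hφ.adjointMap w) (hφ.adjointMap z)
  intro h
  apply h3
  rw [conj_adjointMap, coe_adjointMap]
  rw [gramDenom] at h
  field_simp
  linear_combination h

theorem inner_apply_kernelVec (hφ : IsLinearFractional a b c d φ)
    (hW : IsWeightedComposition (fun z => β * szegoKernel (sigma a b c d 0) z) φ W) (z w : 𝔻) :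
    inner ℂ (W (H2.kernelVec z)) (W (H2.kernelVec w)) =
      β * d * conj (β * d) / gramDenom a b c d z w := by
  have h1 := hφ.adjoint_denom_zero_ne_zero w
  have h2 := (map_ne_zero (starRingEnd ℂ)).mpr (hφ.adjoint_denom_zero_ne_zero z)
  have h4 := hφ.gramDenom_ne_zero z w
  have h3 : 1 - conj (hφ.adjointMap w : ℂ) * hφ.adjointMap z =
      gramDenom a b c d z w / ((d - conj (w : ℂ) * b) * conj (d - conj (z : ℂ) * b)) := by
    simp only [map_sub, map_mul, conj_conj] at h2
    rw [conj_adjointMap, coe_adjointMap, gramDenom]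
    simp only [map_sub, map_mul, conj_conj]
    field_simp
  rw [hφ.apply_kernelVec hW, hφ.apply_kernelVec hW, inner_smul_left, inner_smul_right,
    H2.inner_kernelVec_left, H2.kernelVec_apply, szegoKernel, h3, map_div₀]
  generalize conj (d - conj (z : ℂ) * b) = u at h2
  generalize d - conj (w : ℂ) * b = v at h1
  field_simp

theorem inner_adjoint_kernelVec (hφ : IsLinearFractional a b c d φ)
    (hW : IsWeightedComposition (fun z => β * szegoKernel (sigma a b c d 0) z) φ W) (z w : 𝔻) :
    (c * z + d) * conj (c * w + d) - (a * z + b) * conj (a * w + b) ≠ 0 ∧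
    inner ℂ (ContinuousLinearMap.adjoint W (H2.kernelVec z))
        (ContinuousLinearMap.adjoint W (H2.kernelVec w)) =
      β * d * conj (β * d) /
        ((c * z + d) * conj (c * w + d) - (a * z + b) * conj (a * w + b)) := by
  obtain ⟨h1, h2⟩ := hφ.2 z
  obtain ⟨h3, h4⟩ := hφ.2 w
  have h3' := (map_ne_zero (starRingEnd ℂ)).mpr h3
  have h5 : 1 - conj (φ w : ℂ) * φ z =
      ((c * z + d) * conj (c * w + d) - (a * z + b) * conj (a * w + b)) /
        ((c * z + d) * conj (c * w + d)) := by
    rw [h2, h4, map_div₀, div_mul_div_comm, mul_comm (conj (c * (w : ℂ) + d)),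
      mul_comm (conj (a * (w : ℂ) + b)), one_sub_div (mul_ne_zero h1 h3')]
  have h6 := one_sub_conj_mul_ne_zero (φ w) (φ z)
  rw [h5] at h6
  have h7 := (div_ne_zero_iff.mp h6).1
  refine ⟨h7, ?_⟩
  rw [hW.adjoint_kernelVec, hW.adjoint_kernelVec, inner_smul_left, inner_smul_right,
    H2.inner_kernelVec_left, H2.kernelVec_apply, hφ.weight_eq, hφ.weight_eq, szegoKernel, h5,
    conj_conj, map_div₀]
  generalize (c * (z : ℂ) + d) * conj (c * (w : ℂ) + d) -
    (a * (z : ℂ) + b) * conj (a * (w : ℂ) + b) = u at h7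
  generalize conj (c * (w : ℂ) + d) = v at h3'
  generalize c * (z : ℂ) + d = t at h1
  field_simp

theorem inner_adjoint_kernelVec_of_isStarNormal (hφ : IsLinearFractional a b c d φ)
    (hW : IsWeightedComposition (fun z => β * szegoKernel (sigma a b c d 0) z) φ W)
    (hn : IsStarNormal W) (z w : 𝔻) :
    inner ℂ (ContinuousLinearMap.adjoint W (H2.kernelVec z))
        (ContinuousLinearMap.adjoint W (H2.kernelVec w)) =
      β * d * conj (β * d) / gramDenom a b c d z w := by
  have h : ContinuousLinearMap.adjoint W (W (H2.kernelVec w)) =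
      W (ContinuousLinearMap.adjoint W (H2.kernelVec w)) :=
    congrArg (fun T : H2 →L[ℂ] H2 => T (H2.kernelVec w)) hn.star_comm_self.eq
  rw [← hφ.inner_apply_kernelVec hW, ← ContinuousLinearMap.adjoint_inner_right W, h,
    ContinuousLinearMap.adjoint_inner_left]

/-! ### Normality and `C`-normality as coefficient identities -/

/-- Normality of the weighted composition operator in terms of the coefficients of `φ`. -/
theorem coeffs_of_isStarNormal (hφ : IsLinearFractional a b c d φ) (hβ : β ≠ 0)
    (hW : IsWeightedComposition (fun z => β * szegoKernel (sigma a b c d 0) z) φ W)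
    (hn : IsStarNormal W) :
    b * conj b = c * conj c ∧ a * conj c - b * conj d = conj c * d - conj a * b := by
  have hd : d ≠ 0 := by simpa using (hφ.2 0).1
  have hk : β * d * conj (β * d) ≠ 0 := by simp [hβ, hd]
  have key : ∀ z w : 𝔻, gramDenom a b c d z w =
      (c * z + d) * conj (c * w + d) - (a * z + b) * conj (a * w + b) := by
    intro z w
    obtain ⟨h1, h2⟩ := hφ.inner_adjoint_kernelVec hW z w
    rw [hφ.inner_adjoint_kernelVec_of_isStarNormal hW hn] at h2
    rw [div_eq_mul_inv, div_eq_mul_inv, mul_right_inj' hk, inv_inj] at h2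
    exact h2
  obtain ⟨h1, h2, -, -⟩ := coeffs_eq_zero_of_forall_unitDisc
    (A := b * conj b - c * conj c)
    (B := a * conj c - b * conj d - (conj c * d - conj a * b))
    (C := conj a * c - conj b * d - (c * conj d - a * conj b))
    (D := b * conj b - c * conj c) fun z w => by
      have := key z w
      simp only [gramDenom, map_add, map_mul] at this
      linear_combination this
  exact ⟨sub_eq_zero.mp h1, sub_eq_zero.mp h2⟩

/-- `J_μ` sends `K_w` to `K_{μ w̄}`, which fixes the constant and `z w̄` terms of `gramDenom` and
exchanges the linear ones up to `μ`. -/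
theorem isCNormal_conjJ_iff (hφ : IsLinearFractional a b c d φ) (hβ : β ≠ 0)
    (hW : IsWeightedComposition (fun z => β * szegoKernel (sigma a b c d 0) z) φ W)
    (hn : IsStarNormal W) (μ : Circle) :
    IsCNormal (conjJ μ) W ↔
      (conj c * d - conj a * b) * conj (μ : ℂ) = conj a * c - conj b * d := by
  have hd : d ≠ 0 := by simpa using (hφ.2 0).1
  have hk : β * d * conj (β * d) ≠ 0 := by simp [hβ, hd]
  obtain ⟨-, hE⟩ := hφ.coeffs_of_isStarNormal hβ hW hn
  have hμ := circle_mul_conj μ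
  rw [isCNormal_iff_kernelVec, ← hE]
  simp only [conjJ_kernelVec, hφ.inner_apply_kernelVec hW,
    hφ.inner_adjoint_kernelVec_of_isStarNormal hW hn, div_eq_mul_inv, mul_right_inj' hk, inv_inj]
  simp only [gramDenom, UnitDisc.coe_circle_smul, UnitDisc.coe_star, map_mul, conj_conj]
  constructor
  · intro h
    obtain ⟨-, -, h3, -⟩ := coeffs_eq_zero_of_forall_unitDisc
      (A := 0)
      (B := (conj a * c - conj b * d) * μ - (a * conj c - b * conj d))
      -- The coefficient of `conj w` gives the same condition, multiplied by `-μ`.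
      (C := (a * conj c - b * conj d) * conj (μ : ℂ) - (conj a * c - conj b * d))
      (D := 0) fun z w => by
        linear_combination h z w -
          (b * conj b - a * conj a) * conj (w : ℂ) * (z : ℂ) * hμ
    exact sub_eq_zero.mp h3
  · intro h z w
    linear_combination (b * conj b - a * conj a) * conj (w : ℂ) * (z : ℂ) * hμ +
      ((z : ℂ) - μ * conj (w : ℂ)) * h + (a * conj c - b * conj d) * conj (w : ℂ) * hμ

theorem isCNormal_conjJW_iff (hφ : IsLinearFractional a b c d φ) (hβ : β ≠ 0)
    (hW : IsWeightedComposition (fun z => β * szegoKernel (sigma a b c d 0) z) φ W)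
    (hn : IsStarNormal W) {p : 𝔻} (hp : p ≠ 0) (lam : Circle)
    (hlam : (lam : ℂ) * p = conj (p : ℂ)) :
    IsCNormal (conjJW lam p hlam) W ↔
      (a * conj a - d * conj d) * (p * conj (p : ℂ)) =
        (a * conj c - b * conj d) * p + conj ((a * conj c - b * conj d) * p) := by
  have hd : d ≠ 0 := by simpa using (hφ.2 0).1
  have hk : β * d * conj (β * d) ≠ 0 := by simp [hβ, hd]
  have hp' : (p : ℂ) ≠ 0 := by simpa using hp
  obtain ⟨hbc, -⟩ := hφ.coeffs_of_isStarNormal hβ hW hn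
  have hl := circle_mul_conj lam
  have hlam' : conj (lam : ℂ) * conj (p : ℂ) = p := by
    have := congrArg conj hlam
    simpa using this
  have hs := sqrt_mul_self_xi p
  -- The product of the two weights `ξ_p` contributes `1 - |p|²` over exactly the denominators of
  -- `τ_p`, so clearing fractions leaves a polynomial identity.
  have expand : ∀ z w : 𝔻, inner ℂ (W ((conjJW lam p hlam).toMap (H2.kernelVec w)))
      (W ((conjJW lam p hlam).toMap (H2.kernelVec z))) =
      inner ℂ (ContinuousLinearMap.adjoint W (H2.kernelVec z))
        (ContinuousLinearMap.adjoint W (H2.kernelVec w)) ↔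
      (1 - conj (p : ℂ) * conj (w : ℂ)) * (1 - (p : ℂ) * z) *
        gramDenom a b c d (tau lam p (star w)) (tau lam p (star z)) =
      (1 - (p : ℂ) * conj (p : ℂ)) * gramDenom a b c d z w := by
    intro z w
    have h1 : (1 - (p : ℂ) * z) ≠ 0 := by
      have := one_sub_conj_mul_ne_zero (star p) z
      simpa using this
    have h2 : (1 - conj (p : ℂ) * conj (w : ℂ)) ≠ 0 := by
      simpa using one_sub_conj_mul_ne_zero p (star w)
    have h3 := hφ.gramDenom_ne_zero z w
    have h4 := hφ.gramDenom_ne_zero (tau lam p (star w)) (tau lam p (star z))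
    have h5 : xi p (star w) * conj (xi p (star z)) = (1 - (p : ℂ) * conj (p : ℂ)) /
        ((1 - conj (p : ℂ) * conj (w : ℂ)) * (1 - (p : ℂ) * z)) := by
      simp only [xi, UnitDisc.coe_star, map_div₀, map_sub, map_mul, map_one, conj_conj,
        Complex.conj_ofReal]
      rw [div_mul_div_comm, hs]
    rw [conjJW_kernelVec, conjJW_kernelVec, map_smul, map_smul, inner_smul_left,
      inner_smul_right, conj_conj, hφ.inner_apply_kernelVec hW,
      hφ.inner_adjoint_kernelVec_of_isStarNormal hW hn, ← mul_assoc, h5, div_mul_div_comm,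
      div_eq_div_iff (mul_ne_zero (mul_ne_zero h2 h1) h4) h3]
    constructor
    · intro h
      refine mul_left_cancel₀ hk ?_
      linear_combination -h
    · intro h
      linear_combination -(β * d * conj (β * d)) * h
  have htau : ∀ w : 𝔻, (tau lam p (star w) : ℂ) * (1 - conj (p : ℂ) * conj (w : ℂ)) =
      conj (p : ℂ) - lam * conj (w : ℂ) := by
    intro w
    have h2 : (1 - conj (p : ℂ) * conj (w : ℂ)) ≠ 0 := by
      simpa using one_sub_conj_mul_ne_zero p (star w)
    rw [coe_tau, UnitDisc.coe_star, div_mul_cancel₀ _ h2]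
    linear_combination hlam
  have htau' : ∀ z : 𝔻, conj (tau lam p (star z) : ℂ) * (1 - (p : ℂ) * z) =
      p - conj (lam : ℂ) * z := by
    intro z
    have := congrArg conj (htau z)
    simpa only [map_mul, map_sub, map_one, conj_conj] using this
  -- The defect factors as a scalar times a polynomial independent of `a, b, c, d`. The factor
  -- `|p|²` allows `λ` and its conjugate to be eliminated through `λ p = p̄`; the relation `|b| =
  -- |c|` is what produces `|a|² - |d|²`.
  have key : ∀ z w : 𝔻, p * conj (p : ℂ) *
      ((1 - conj (p : ℂ) * conj (w : ℂ)) * (1 - (p : ℂ) * z) *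
        gramDenom a b c d (tau lam p (star w)) (tau lam p (star z)) -
      (1 - (p : ℂ) * conj (p : ℂ)) * gramDenom a b c d z w) =
      ((a * conj c - b * conj d) * p + conj ((a * conj c - b * conj d) * p) -
        (a * conj a - d * conj d) * (p * conj (p : ℂ))) *
      (p * conj (p : ℂ) - conj (w : ℂ) * conj (p : ℂ) - z * p +
        conj (w : ℂ) * z * (p * conj (p : ℂ))) := by
    intro z w
    have hM : (1 - conj (p : ℂ) * conj (w : ℂ)) * (1 - (p : ℂ) * z) *
        gramDenom a b c d (tau lam p (star w)) (tau lam p (star z)) =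
        (conj d * (1 - conj (p : ℂ) * conj (w : ℂ)) - (conj (p : ℂ) - lam * conj (w : ℂ)) * conj b) *
          (d * (1 - (p : ℂ) * z) - (p - conj (lam : ℂ) * z) * b) -
        ((conj (p : ℂ) - lam * conj (w : ℂ)) * conj a -
          conj c * (1 - conj (p : ℂ) * conj (w : ℂ))) *
          ((p - conj (lam : ℂ) * z) * a - c * (1 - (p : ℂ) * z)) := by
      rw [← htau, ← htau', gramDenom]
      ring
    rw [hM, gramDenom]
    simp only [map_mul, map_sub, conj_conj]
    linear_combination
      (p * conj (p : ℂ) * ((conj a * c - conj b * d) * conj (w : ℂ) * z +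
          (a * conj a - b * conj b) * conj (w : ℂ)) -
        (conj a * c - conj b * d) * conj (w : ℂ) * conj (p : ℂ)) * hlam +
      (p * conj (p : ℂ) * ((a * conj c - b * conj d) * conj (w : ℂ) * z +
          (a * conj a - b * conj b) * z) - (a * conj c - b * conj d) * z * p) * hlam' -
      p * conj (p : ℂ) * (a * conj a - b * conj b) * conj (w : ℂ) * z * hl +
      p * conj (p : ℂ) * (p * conj (p : ℂ) - conj (w : ℂ) * conj (p : ℂ) - z * p +
        conj (w : ℂ) * z * (p * conj (p : ℂ))) * hbc
  have hpp : (p : ℂ) * conj (p : ℂ) ≠ 0 := mul_ne_zero hp' ((map_ne_zero _).mpr hp')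
  simp only [isCNormal_iff_kernelVec, expand]
  constructor
  · intro h
    -- At the origin the fixed polynomial equals `|p|² ≠ 0`, so the scalar must vanish.
    have h0 := key 0 0
    rw [h 0 0, sub_self, mul_zero] at h0
    simp only [UnitDisc.coe_zero, map_zero, zero_mul, sub_zero, add_zero] at h0
    exact (sub_eq_zero.mp ((mul_eq_zero.mp h0.symm).resolve_right hpp)).symm
  · intro h z w
    have h0 := key z w
    rw [sub_eq_zero.mpr h.symm, zero_mul] at h0
    exact sub_eq_zero.mp ((mul_eq_zero.mp h0).resolve_left hpp)

end IsLinearFractional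

theorem mainTheorem6 (p : 𝔻) (hp : p ≠ 0) (lam : Circle) (hlam : (lam : ℂ) * p = conj (p : ℂ))
    (μ : Circle) (a b c d β : ℂ) (hβ : β ≠ 0) (φ : 𝔻 → 𝔻) (hφ : IsLinearFractional a b c d φ)
    (hfix : HasBoundaryFixedPoint a b c d) (W : H2 →L[ℂ] H2)
    (hW : IsWeightedComposition (fun z => β * szegoKernel (sigma a b c d 0) z) φ W)
    (hnormal : IsStarNormal W) :
    (IsCNormal (conjJ μ) W ↔
      (conj c * d - conj a * b) * conj (μ : ℂ) = conj a * c - conj b * d) ∧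
    (IsCNormal (conjJW lam p hlam) W ↔
      (a * conj b - c * conj d = conj b * d - conj a * c ∧
        (‖a‖ ^ 2 - ‖d‖ ^ 2) * ‖(p : ℂ)‖ ^ 2 = 2 * ((a * conj c - b * conj d) * p).re)) := by
  obtain ⟨-, hE⟩ := hφ.coeffs_of_isStarNormal hβ hW hnormal
  refine ⟨hφ.isCNormal_conjJ_iff hβ hW hnormal μ, ?_⟩
  rw [hφ.isCNormal_conjJW_iff hβ hW hnormal hp lam hlam]
  -- The first equation of (ii) is the conjugate of a consequence of normality, so only the second
  -- one carries information.
  have h1 : a * conj b - c * conj d = conj b * d - conj a * c := by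
    have := congrArg conj hE
    simp only [map_sub, map_mul, conj_conj] at this
    linear_combination this
  rw [Complex.add_conj, Complex.mul_conj, Complex.mul_conj, Complex.mul_conj,
    Complex.normSq_eq_norm_sq, Complex.normSq_eq_norm_sq, Complex.normSq_eq_norm_sq]
  refine Iff.trans ?_ (and_iff_right h1).symm
  norm_cast
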